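/- **Setting.** Formulae of multiplicative linear logic with units ($\mathit{MLL}_u$) are $A ::= X \mid 1 \mid \bot \mid A\otimes A \mid A ⅋ A$, with $X$ ranging over countably many atoms equipped with a fixed-point-free involution $(\cdot)^\perp$, extended by De Morgan duality. The fragment $(\neg\bot\otimes)LL$ consists of the formulae of kind $A$ or $E$, where $$A ::= X \mid 1 \mid A\otimes A\mid A ⅋ A\mid A ⅋ E\mid E ⅋ A,\qquad E ::= \bot\mid E ⅋ E.$$ A *proof-structure* is a finite directed acyclic multigraph with nodes labelled $\mathtt{ax}$ (0 premises, 2 conclusions), $\mathtt{cut}$ (2, 0), $1$ and $\bot$ (0, 1), $\otimes$ and $⅋$ (2, 1), $\bullet$ (1, 0), where the premises (conclusions) of a node are its incoming (outgoing) arcs, together with an ordering of the two premises of each $\otimes$ and $⅋$ node, a total ordering of the premises of the $\bullet$ nodes, and a partial *jump function* $J_R$ from $\bot$ nodes to arbitrary nodes. It is a proof-structure of $(\neg\bot\otimes)LL$ if its arcs are labelled by formulae of that fragment, compatibly with the nodes (dual types on the conclusions of an $\mathtt{ax}$ and on the premises of a $\mathtt{cut}$; $1$, $\bot$, $\otimes$,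 $⅋$ nodes introduce the corresponding connective). It is cut-free if it has no $\mathtt{cut}$ node. A *switching* $\varphi$ chooses one premise of each $⅋$ node; the *switching graph* $R^\varphi$ is obtained by redirecting the non-chosen premise of each $⅋$ node to a fresh $\bullet$ node and by adding an arc from $n$ to $J_R(n)$ for each $n\in\mathrm{dom}(J_R)$. $R$ is *jump-correct* if $J_R$ is total on the $\bot$ nodes and every $R^\varphi$ is, as an undirected multigraph, acyclic with exactly one connected component. $\langle R\rangle$ denotes $R$ with all its jumps erased. *Rewiring equivalence* $\approx$ is the smallest equivalence relation on jump-correct proof-structures relating $R$ and $R'$ whenever $R'$ is obtained from $R$ by redirecting exactly one jump. Write $n\prec n'$ if there is a non-empty directed path of $R$ (not using jumps) from $n$ to $n'$. A node is *erasing* if it is a $\bot$, $⅋$ or $\bullet$ node all of whose premises are conclusions of erasing nodes (inductively). For a node $m$ of a cut-free proof-structure $R$ of $(\neg\bot\otimes)LL$, $\langle R\rangle_{\mathsf w}^m$ is $\langle R\rangle$ equipped with the following jumps, for each $\bot$ node $n$: if $n\prec n_0$ for some non-erasing $⅋$ node $n_0$, then, taking the $\prec$-least such $n_0$, $n$ jumps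 to the non-erasing node one of whose conclusions is a premise of $n_0$; otherwise $n$ jumps to $m$. **Theorem.** 1. For every jump-correct cut-free proof-structure $R$ of $(\neg\bot\otimes)LL$ and every non-erasing node $m$ of $R$, $\langle R\rangle_{\mathsf w}^m$ is jump-correct and $R\approx\langle R\rangle_{\mathsf w}^m$. 2. For all jump-correct cut-free proof-structures $R_1,R_2$ of $(\neg\bot\otimes)LL$, if $\langle R_1\rangle=\langle R_2\rangle$, then $R_1\approx R_2$. -/

import Mathlib

/-- Formulae of multiplicative linear logic with units. The countably infinite set of atomic
formulae is `ℕ × Bool`; linear negation flips the Boolean (an involution without fixed points). -/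
inductive MLLFormula : Type
  | atom (x : ℕ) (positive : Bool) : MLLFormula
  | one : MLLFormula
  | bot : MLLFormula
  | tensor (A B : MLLFormula) : MLLFormula
  | par (A B : MLLFormula) : MLLFormula

namespace MLLFormula

/-- Linear negation. -/
def dual : MLLFormula → MLLFormula
  | atom x p => atom x (!p)
  | one => bot
  | bot => one
  | tensor A B => par A.dual B.dual
  | par A B => tensor A.dual B.dual

/-- Formulae of kind `E ::= ⊥ | E ⅋ E`. -/
inductive KindE : MLLFormula → Prop
  | bot : KindE bot
  | par {E F : MLLFormula} : KindE E → KindE F → KindE (par E F)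

/-- Formulae of kind `A ::= X | 1 | A ⊗ A | A ⅋ A | A ⅋ E | E ⅋ A`. -/
inductive KindA : MLLFormula → Prop
  | atom (x : ℕ) (p : Bool) : KindA (atom x p)
  | one : KindA one
  | tensor {A B : MLLFormula} : KindA A → KindA B → KindA (tensor A B)
  | parAA {A B : MLLFormula} : KindA A → KindA B → KindA (par A B)
  | parAE {A E : MLLFormula} : KindA A → KindE E → KindA (par A E)
  | parEA {E A : MLLFormula} : KindE E → KindA A → KindA (par E A)

/-- The fragment `(¬⊥⊗)LL`: all formulae of kind `A` or of kind `E`. -/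
def notBotTensorLL : Set MLLFormula := {F | KindA F ∨ KindE F}

end MLLFormula

/-- The labels of the nodes of a proof-structure; `bullet` is `•`. -/
inductive NodeLabel : Type
  | ax | cut | one | bot | tensor | par | bullet

namespace NodeLabel

/-- The number of premises of a node of a proof-structure. -/
def numPremises : NodeLabel → ℕ
  | ax => 0
  | cut => 2
  | one => 0
  | bot => 0
  | tensor => 2
  | par => 2
  | bullet => 1

/-- The number of conclusions of a node of a proof-structure. -/
def numConclusions : NodeLabel → ℕ
  | ax => 2
  | cut => 0
  | one => 1
  | bot => 1
  | tensor => 1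
  | par => 1
  | bullet => 0

end NodeLabel

/-- A directed graph with nodes `V` and arcs `E`; parallel arcs are allowed. -/
structure ArcGraph (V E : Type*) where
  tail : E → V
  head : E → V

namespace ArcGraph

variable {V E : Type*} (G : ArcGraph V E)

/-- There is an arc with tail `m` and head `n`. -/
def Arrow (m n : V) : Prop := ∃ a, G.tail a = m ∧ G.head a = n

/-- A path `n₀ a₁ n₁ … aₖ nₖ` of length `k`, with arcs crossed in either direction, in which no node
is repeated except that the first may be the last, and whose first and last arcs are distinct when
`k ≥ 2`. -/
structure UPath (k : ℕ) where
  node : Fin (k + 1) → V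
  arc : Fin k → E
  ends : ∀ i : Fin k,
    (G.tail (arc i) = node i.castSucc ∧ G.head (arc i) = node i.succ) ∨
    (G.tail (arc i) = node i.succ ∧ G.head (arc i) = node i.castSucc)
  simple : ∀ i j : Fin (k + 1), i ≠ j → node i = node j →
    (i = 0 ∧ j = Fin.last k) ∨ (i = Fin.last k ∧ j = 0)
  arc_ne : ∀ i j : Fin k, i.val = 0 → j.val = k - 1 → 2 ≤ k → arc i ≠ arc j

/-- No path of positive length comes back to its first node. An arc from a node to itself
is a cycle of length one, and two parallel arcs form a cycle of length two. -/
def Acyclic : Prop := ∀ (k : ℕ) (γ : G.UPath k), 0 < k → γ.node 0 ≠ γ.node (Fin.last k)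

/-- The connected components of the underlying undirected graph: the classes of nodes for the
equivalence relation generated by adjacency. -/
def Component : Type _ := Quot G.Arrow

/-- Having exactly one connected component (so the empty graph is excluded). -/
def OneComponent : Prop := Nat.card G.Component = 1

end ArcGraph

/-- A (finite, untyped) proof-structure with nodes `N` and arcs `A`, equipped with a partial jump
function from its `⊥` nodes to its nodes. -/
structure ProofStructure (N A : Type*) extends ArcGraph N A where
  finite_nodes : Finite N
  finite_arcs : Finite A
  label : N → NodeLabel
  /-- no directed cycle -/
  dag : ∀ n, ¬ Relation.TransGen toArcGraph.Arrow n n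
  card_premises : ∀ n, {a | head a = n}.encard = (label n).numPremises
  card_conclusions : ∀ n, {a | tail a = n}.encard = (label n).numConclusions
  /-- the left premise of a `⊗` or `⅋` node -/
  left : {n // label n = .tensor ∨ label n = .par} → A
  /-- the right premise of a `⊗` or `⅋` node -/
  right : {n // label n = .tensor ∨ label n = .par} → A
  head_left : ∀ n, head (left n) = n
  head_right : ∀ n, head (right n) = n
  left_ne_right : ∀ n, left n ≠ right n
  /-- the conclusions of the proof-structure, i.e. the premises of its `•` nodes, in order -/
  conclusions : List A
  nodup_conclusions : conclusions.Nodup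
  mem_conclusions : ∀ a, a ∈ conclusions ↔ label (head a) = .bullet
  /-- the partial jump function; `none` means undefined -/
  jump : {n // label n = .bot} → Option N

namespace ProofStructure

variable {N A : Type*} (R : ProofStructure N A)

/-- There are no `cut` nodes. -/
def CutFree : Prop := ∀ n, R.label n ≠ .cut

/-- `n ≺ n'`: there is a non-empty descent path from `n` to `n'`. Jumps are not arcs of `R`. -/
def Prec (n n' : N) : Prop := Relation.TransGen R.toArcGraph.Arrow n n'

/-- Erasing nodes: the `⊥`, `⅋` or `•` nodes whose premises are all conclusions of
erasing nodes. -/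
inductive Erasing : N → Prop
  | intro (n : N)
      (hlabel : R.label n = .bot ∨ R.label n = .par ∨ R.label n = .bullet)
      (hprem : ∀ a, R.head a = n → Erasing (R.tail a)) : Erasing n

/-- A switching maps every `⅋` node to one of its premises. -/
structure Switching where
  choice : {n // R.label n = .par} → A
  head_choice : ∀ n, R.head (choice n) = n

open Classical in
/-- The head, in the switching graph, of an arc of `R`: the premise of a `⅋` node which is not
chosen is redirected to the fresh `•` node `Sum.inr n` associated with that `⅋` node `n`. -/
noncomputable def switchedHead (φ : R.Switching) (a : A) : N ⊕ {n // R.label n = .par} :=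
  if h : R.label (R.head a) = .par then
    if φ.choice ⟨R.head a, h⟩ = a then Sum.inl (R.head a) else Sum.inr ⟨R.head a, h⟩
  else Sum.inl (R.head a)

/-- The switching graph of `R` induced by `φ`, including one arc (jump) from `n` to its image
for each `⊥` node `n` in the domain of the jump function. -/
noncomputable def switchingGraph (φ : R.Switching) :
    ArcGraph (N ⊕ {n // R.label n = .par})
      (A ⊕ {n : {n // R.label n = .bot} // (R.jump n).isSome}) where
  tail := Sum.elim (fun a => Sum.inl (R.tail a)) (fun n => Sum.inl n.1.1)
  head := Sum.elim (R.switchedHead φ) (fun n => Sum.inl ((R.jump n.1).get n.2))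

/-- Every switching graph is acyclic. -/
def SatisfiesAC : Prop := ∀ φ : R.Switching, (R.switchingGraph φ).Acyclic

/-- Every switching graph has exactly one connected component. -/
def SatisfiesC : Prop := ∀ φ : R.Switching, (R.switchingGraph φ).OneComponent

/-- The jump function is defined on every `⊥` node. -/
def JumpTotal : Prop := ∀ n, (R.jump n).isSome

/-- Jump-total, with acyclic and connected switching graphs. -/
def JumpCorrect : Prop := R.JumpTotal ∧ R.SatisfiesAC ∧ R.SatisfiesC

/-- `n₀` is the least non-erasing `⅋` node below `n`. -/
def IsLeastNonErasingPar (n n₀ : N) : Prop :=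
  (R.label n₀ = .par ∧ ¬ R.Erasing n₀ ∧ R.Prec n n₀) ∧
  ∀ n₁, R.label n₁ = .par → ¬ R.Erasing n₁ → R.Prec n n₁ → n₁ = n₀ ∨ R.Prec n₀ n₁

/-- The `⊥` node `n` lies above some non-erasing `⅋` node (the set `w_⅋`). -/
def AboveNonErasingPar (n : {n // R.label n = .bot}) : Prop :=
  ∃ n₀, R.label n₀ = .par ∧ ¬ R.Erasing n₀ ∧ R.Prec n n₀

/-- `n'` is a non-erasing node with a conclusion that is a premise of the least non-erasing
`⅋` node below `n`. -/
def IsCanonicalTarget (n : {n // R.label n = .bot}) (n' : N) : Prop :=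
  ¬ R.Erasing n' ∧ ∃ n₀, R.IsLeastNonErasingPar n n₀ ∧ R.toArcGraph.Arrow n' n₀

open Classical in
/-- The canonical jump of a `⊥` node above a non-erasing `⅋` node. -/
noncomputable def canonicalTarget (n : {n // R.label n = .bot}) : Option N :=
  if h : ∃ n', R.IsCanonicalTarget n n' then some h.choose else none

open Classical in
/-- The jump function defined only on the `⊥` nodes above a non-erasing `⅋` node, which sends each
of them to its canonical target. -/
noncomputable def canonicalJump (n : {n // R.label n = .bot}) : Option N :=
  if R.AboveNonErasingPar n then R.canonicalTarget n else none

open Classical in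
/-- The extension of the canonical jump function which sends all the other `⊥` nodes to `m`. -/
noncomputable def canonicalJumpExt (m : N) (n : {n // R.label n = .bot}) : Option N :=
  if R.AboveNonErasingPar n then R.canonicalJump n else some m

end ProofStructure

/-- A proof-structure of `MLL` with units: its arcs are labelled by formulae (types). -/
structure TypedProofStructure (N A : Type*) extends ProofStructure N A where
  type : A → MLLFormula
  type_ax : ∀ a a', a ≠ a' → tail a = tail a' → label (tail a) = .ax → type a = (type a').dual
  type_cut : ∀ a a', a ≠ a' → head a = head a' → label (head a) = .cut → type a = (type a').dual
  type_one : ∀ a, label (tail a) = .one → type a = .one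
  type_bot : ∀ a, label (tail a) = .bot → type a = .bot
  type_tensor : ∀ a (h : label (tail a) = .tensor),
    type a = .tensor (type (left ⟨tail a, Or.inl h⟩)) (type (right ⟨tail a, Or.inl h⟩))
  type_par : ∀ a (h : label (tail a) = .par),
    type a = .par (type (left ⟨tail a, Or.inr h⟩)) (type (right ⟨tail a, Or.inr h⟩))

namespace TypedProofStructure

variable {N A : Type*} (R : TypedProofStructure N A)

/-- `R` is a proof-structure of `F`: all its arcs are typed by formulae of `F`. -/
def InFragment (F : Set MLLFormula) : Prop := ∀ a, R.type a ∈ F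

/-- The proof-structure obtained from `R` by replacing its jump function by `J`. -/
def withJump (J : {n // R.label n = .bot} → Option N) : TypedProofStructure N A :=
  { R with jump := J }

/-- The underlying jump-free proof-structure. -/
def underlyingJumpFree : TypedProofStructure N A := R.withJump (fun _ => none)

/-- The canonical-jump version of `R` relative to the node `m`: all jumps of `R` are erased, the `⊥`
nodes above a non-erasing `⅋` node are given their canonical jump, and the others jump to `m`. -/
noncomputable def canonicalJumpVersion (m : N) : TypedProofStructure N A :=
  R.underlyingJumpFree.withJump (R.underlyingJumpFree.canonicalJumpExt m)

open Classical in
/-- `R'` is obtained from `R` by redirecting exactly one jump. -/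
def Redirect (R R' : TypedProofStructure N A) : Prop :=
  ∃ (n : {n // R.label n = .bot}) (m m' : N), R.jump n = some m ∧ m' ≠ m ∧
    R' = R.withJump (Function.update R.jump n (some m'))

/-- Rewiring equivalence: the smallest equivalence relation on jump-correct proof-structures
which contains the redirections of exactly one jump. -/
def RewiringEquiv (R R' : {R : TypedProofStructure N A // R.JumpCorrect}) : Prop :=
  Relation.EqvGen (fun S S' => Redirect S.1 S'.1) R R'

end TypedProofStructure

/-! Correctness says that every switching graph is a tree, and moving the head of a jump keeps a
tree a tree as soon as the old and new targets are joined without that jump (`IsTree.redirect`).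
Each rewiring thus amounts to finding, in every switching graph, a connection that avoids one jump.

Jumps are first cleared off the erasing nodes. The premises of a ⅋ are joined off that ⅋
(`linked_premises`), so a jump can climb from any erasing node up to a ⊥; jumps between ⊥ nodes form
no cycle, so they can be short-circuited until every target is non-erasing
(`exists_rewires_not_erasing`).

Then, in a switching graph, the erasing nodes met on the way down from a ⊥ node `n` form a thread
attached to the rest only by the jump of `n` and at most one exit. Contract this thread onto the
target of `n`. Without an exit, connectedness lets the jump go to any non-erasing node; with an exit
into a ⅋, the connection between the premises of that ⅋ becomes one from the target of `n` to the
origin of the other premise (`update_target`). Treating the ⊥ nodes one by one yields the canonical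
jumps. The fragment and cut-freeness serve to make every such exit land on a ⅋ (`erasingAbovePar`).
The second claim follows because the canonical version depends only on the jump-free structure and
on `m`. -/

namespace ArcGraph

/-! ### Multigraphs: connection, bridges and trees. -/

variable {V E V' E' : Type*}

/-- The nodes `u` and `v` are connected, in the underlying undirected graph, by arcs in `P`. -/
def Linked (G : ArcGraph V E) (P : E → Prop) : V → V → Prop :=
  Relation.EqvGen fun u v => ∃ a, P a ∧ G.tail a = u ∧ G.head a = v

namespace Linked

variable {G : ArcGraph V E} {P Q : E → Prop} {u v w : V}

theorem refl (u : V) : G.Linked P u u := Relation.EqvGen.refl u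

theorem symm (h : G.Linked P u v) : G.Linked P v u := Relation.EqvGen.symm _ _ h

theorem trans (h : G.Linked P u v) (h' : G.Linked P v w) : G.Linked P u w :=
  Relation.EqvGen.trans _ _ _ h h'

theorem of_arc {a : E} (h : P a) : G.Linked P (G.tail a) (G.head a) :=
  Relation.EqvGen.rel _ _ ⟨a, h, rfl, rfl⟩

/-- Arcs need only go to connected pairs, so `r` may collapse part of the graph to a point; this is
how unwanted arcs are eliminated below. -/
theorem lift {G' : ArcGraph V' E'} {Q : E' → Prop} (r : V → V')
    (hr : ∀ a, P a → G'.Linked Q (r (G.tail a)) (r (G.head a))) (h : G.Linked P u v) :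
    G'.Linked Q (r u) (r v) := by
  induction h with
  | rel x y h => obtain ⟨a, ha, rfl, rfl⟩ := h; exact hr a ha
  | refl x => exact refl _
  | symm x y _ ih => exact ih.symm
  | trans x y z _ _ ih₁ ih₂ => exact ih₁.trans ih₂

theorem congr {G' : ArcGraph V E'} {Q : E' → Prop} (f : E → E')
    (hf : ∀ a, P a → Q (f a) ∧ G'.tail (f a) = G.tail a ∧ G'.head (f a) = G.head a)
    (h : G.Linked P u v) : G'.Linked Q u v := by
  refine lift (r := id) (fun a ha => ?_) h
  obtain ⟨h₁, h₂, h₃⟩ := hf a ha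
  simpa [h₂, h₃] using of_arc (G := G') h₁

theorem mono (hPQ : ∀ a, P a → Q a) (h : G.Linked P u v) : G.Linked Q u v :=
  congr (f := id) (fun a ha => ⟨hPQ a ha, rfl, rfl⟩) h

/-- Connections after the addition of one arc. -/
theorem of_insert {e : E} (hP : ∀ a, P a → a = e ∨ Q a) (h : G.Linked P u v) :
    G.Linked Q u v ∨ (G.Linked Q u (G.tail e) ∧ G.Linked Q (G.head e) v) ∨
      (G.Linked Q u (G.head e) ∧ G.Linked Q (G.tail e) v) := by
  induction h with
  | rel x y h =>
    obtain ⟨a, ha, rfl, rfl⟩ := h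
    rcases hP a ha with rfl | ha
    · exact Or.inr (Or.inl ⟨refl _, refl _⟩)
    · exact Or.inl (of_arc ha)
  | refl x => exact Or.inl (refl _)
  | symm x y _ ih =>
    rcases ih with h | ⟨h, h'⟩ | ⟨h, h'⟩
    · exact Or.inl h.symm
    · exact Or.inr (Or.inr ⟨h'.symm, h.symm⟩)
    · exact Or.inr (Or.inl ⟨h'.symm, h.symm⟩)
  | trans x y z _ _ ih₁ ih₂ =>
    rcases ih₁ with h | ⟨h, h'⟩ | ⟨h, h'⟩ <;> rcases ih₂ with k | ⟨k, k'⟩ | ⟨k, k'⟩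
    · exact Or.inl (h.trans k)
    · exact Or.inr (Or.inl ⟨h.trans k, k'⟩)
    · exact Or.inr (Or.inr ⟨h.trans k, k'⟩)
    · exact Or.inr (Or.inl ⟨h, h'.trans k⟩)
    · exact Or.inr (Or.inl ⟨h, k'⟩)
    · exact Or.inl (h.trans k')
    · exact Or.inr (Or.inr ⟨h, h'.trans k⟩)
    · exact Or.inl (h.trans k')
    · exact Or.inr (Or.inr ⟨h, k'⟩)

end Linked

variable {G : ArcGraph V E}

/-- The underlying undirected graph is a tree: it is connected and every arc is a bridge. -/
structure IsTree (G : ArcGraph V E) : Prop where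
  bridge : ∀ a, ¬ G.Linked (· ≠ a) (G.tail a) (G.head a)
  nonempty : Nonempty V
  connected : ∀ u v, G.Linked (fun _ => True) u v

theorem oneComponent_iff :
    G.OneComponent ↔ Nonempty V ∧ ∀ u v, G.Linked (fun _ => True) u v := by
  have key : ∀ u v, G.Linked (fun _ => True) u v ↔ Quot.mk G.Arrow u = Quot.mk G.Arrow v := by
    intro u v
    rw [Quot.eq]
    have : (fun u v => ∃ a, True ∧ G.tail a = u ∧ G.head a = v) = G.Arrow := by
      funext u v; simp [Arrow]
    rw [Linked, this]
  rw [OneComponent, Nat.card_eq_one_iff_unique]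
  constructor
  · rintro ⟨h₁, ⟨x⟩⟩
    exact ⟨x.exists_rep.nonempty, fun u v => (key u v).2 (h₁.elim _ _)⟩
  · rintro ⟨⟨x⟩, h⟩
    refine ⟨⟨?_⟩, ⟨Quot.mk _ x⟩⟩
    rintro ⟨u⟩ ⟨v⟩
    exact (key u v).1 (h u v)

theorem Acyclic.not_linked (hG : G.Acyclic) (a : E) :
    ¬ G.Linked (· ≠ a) (G.tail a) (G.head a) := by
  intro hl
  let H : SimpleGraph V := SimpleGraph.fromRel fun u v => ∃ b, b ≠ a ∧ G.tail b = u ∧ G.head b = v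
  have hreach : ∀ u v, G.Linked (· ≠ a) u v → H.Reachable u v := by
    intro u v h
    induction h with
    | rel x y h =>
      by_cases hxy : x = y
      · rw [hxy]
      · exact SimpleGraph.Adj.reachable ((SimpleGraph.fromRel_adj _ _ _).2 ⟨hxy, Or.inl h⟩)
    | refl x => exact SimpleGraph.Reachable.refl x
    | symm x y _ ih => exact ih.symm
    | trans x y z _ _ ih₁ ih₂ => exact ih₁.trans ih₂
  obtain ⟨p, hp⟩ := (hreach _ _ hl).exists_isPath
  have hinj := hp.getVert_injOn
  have harc : ∀ i, i < p.length → ∃ b, b ≠ a ∧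
      ((G.tail b = p.getVert i ∧ G.head b = p.getVert (i + 1)) ∨
        (G.tail b = p.getVert (i + 1) ∧ G.head b = p.getVert i)) := by
    intro i hi
    have := ((SimpleGraph.fromRel_adj _ _ _).1 (p.adj_getVert_succ hi)).2
    rcases this with ⟨b, h, h₁, h₂⟩ | ⟨b, h, h₁, h₂⟩
    · exact ⟨b, h, Or.inl ⟨h₁, h₂⟩⟩
    · exact ⟨b, h, Or.inr ⟨h₁, h₂⟩⟩
  have : Nonempty E := ⟨a⟩
  choose! b hb hends using harc
  -- The simple path `p` from tail to head of `a`, closed up by `a` itself as its last arc. A loop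
  -- `a` gives `p.length = 0` and a cycle of length one.
  let γ : G.UPath (p.length + 1) :=
    { node := fun i => if i.val = p.length + 1 then G.tail a else p.getVert i
      arc := fun i => if i.val = p.length then a else b i
      ends := by
        intro i
        by_cases hi : i.val = p.length
        · right
          simp [hi]
        · have hi' : i.val < p.length := by omega
          have h₁ : i.val ≠ p.length + 1 := by omega
          simpa [hi, h₁] using hends i hi'
      simple := by
        intro i j hij h
        have hne : i.val ≠ j.val := fun h => hij (Fin.ext h)
        have hi := i.isLt
        have hj := j.isLt
        have h0 : p.getVert 0 = G.tail a := p.getVert_zero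
        simp only [Fin.ext_iff, Fin.val_zero, Fin.val_last]
        split_ifs at h with hi' hj' hj'
        · omega
        · have := hinj (show (0 : ℕ) ∈ {i | i ≤ p.length} by simp)
            (show (j : ℕ) ∈ {i | i ≤ p.length} by simp; omega) (h0.trans h)
          omega
        · have := hinj (show (0 : ℕ) ∈ {i | i ≤ p.length} by simp)
            (show (i : ℕ) ∈ {i | i ≤ p.length} by simp; omega) (h0.trans h.symm)
          omega
        · have := hinj (show (i : ℕ) ∈ {i | i ≤ p.length} by simp; omega)
            (show (j : ℕ) ∈ {i | i ≤ p.length} by simp; omega) h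
          omega
      arc_ne := by
        intro i j hi hj hk
        have h₁ : i.val ≠ p.length := by omega
        have h₂ : j.val = p.length := by omega
        simpa [h₁, h₂] using hb i (by omega) }
  refine hG _ γ (Nat.succ_pos _) ?_
  simp [γ]

/-- The arcs of a closed path other than its first one join the two ends of the first one. -/
theorem acyclic_of_not_linked (h : ∀ a, ¬ G.Linked (· ≠ a) (G.tail a) (G.head a)) :
    G.Acyclic := by
  intro k γ hk hγ
  let z : Fin k := ⟨0, hk⟩
  have hnode : ∀ i j : ℕ, ∀ (hi : i < k + 1) (hj : j < k + 1), i ≠ j →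
      γ.node ⟨i, hi⟩ = γ.node ⟨j, hj⟩ → (i = 0 ∧ j = k) ∨ (i = k ∧ j = 0) := by
    intro i j hi hj hij heq
    have := γ.simple ⟨i, hi⟩ ⟨j, hj⟩ (by simpa using hij) heq
    simpa [Fin.ext_iff] using this
  -- Simplicity of the nodes lets the first arc recur only at position 1 of a cycle of length 2, and
  -- `arc_ne` excludes that case.
  have hne : ∀ i : ℕ, ∀ hi : i < k, 0 < i → γ.arc ⟨i, hi⟩ ≠ γ.arc z := by
    intro i hi hpos heq
    have e₁ := γ.ends ⟨i, hi⟩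
    have e₀ := γ.ends z
    rw [heq] at e₁
    simp only [z, Fin.castSucc_mk, Fin.succ_mk] at e₀ e₁
    have c₁ : γ.node ⟨i, by omega⟩ ≠ γ.node ⟨0, by omega⟩ := fun hh => by
      have := hnode _ _ _ _ (by omega) hh; omega
    have c₂ : γ.node ⟨i, by omega⟩ = γ.node ⟨0 + 1, by omega⟩ := by
      grind
    have hi1 : i = 1 := by
      by_contra hi1
      have := hnode _ _ _ _ (by omega) c₂; omega
    subst hi1
    have c₃ : γ.node ⟨1 + 1, by omega⟩ = γ.node ⟨0, by omega⟩ := by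
      grind
    have := hnode _ _ _ _ (by omega) c₃
    exact γ.arc_ne z ⟨1, hi⟩ rfl (by simp; omega) (by omega) heq.symm
  have hlink : ∀ i : ℕ, 0 < i → ∀ hi : i < k + 1,
      G.Linked (· ≠ γ.arc z) (γ.node ⟨1, by omega⟩) (γ.node ⟨i, hi⟩) := by
    intro i hpos
    induction i, hpos using Nat.le_induction with
    | base => intro _; exact Linked.refl _
    | succ i hpos ih =>
      intro hi
      refine (ih (by omega)).trans ?_
      have hl := Linked.of_arc (G := G) (P := (· ≠ γ.arc z)) (hne i (by omega) hpos)
      rcases γ.ends ⟨i, by omega⟩ with ⟨h₁, h₂⟩ | ⟨h₁, h₂⟩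
      · rw [h₁, h₂] at hl; exact hl
      · rw [h₁, h₂] at hl; exact hl.symm
  have hend : G.Linked (· ≠ γ.arc z) (γ.node ⟨1, by omega⟩) (γ.node 0) := by
    rw [hγ]; exact hlink k hk (by omega)
  rcases γ.ends z with ⟨h₁, h₂⟩ | ⟨h₁, h₂⟩
  · apply h (γ.arc z); rw [h₁, h₂]; exact hend.symm
  · apply h (γ.arc z); rw [h₁, h₂]; exact hend

theorem isTree_iff : G.IsTree ↔ G.Acyclic ∧ G.OneComponent := by
  rw [oneComponent_iff]
  exact ⟨fun h => ⟨acyclic_of_not_linked h.bridge, h.nonempty, h.connected⟩,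
    fun h => ⟨h.1.not_linked, h.2.1, h.2.2⟩⟩

/-- Being a tree is invariant under renaming of the arcs. -/
theorem IsTree.of_equiv {G' : ArcGraph V E'} (hG : G.IsTree) (f : E ≃ E')
    (ht : ∀ a, G'.tail (f a) = G.tail a) (hh : ∀ a, G'.head (f a) = G.head a) : G'.IsTree where
  bridge a h := by
    obtain ⟨a, rfl⟩ := f.surjective a
    rw [ht, hh] at h
    refine hG.bridge a (h.congr f.symm fun b hb => ⟨?_, ?_, ?_⟩)
    · rintro rfl; simp at hb
    · simpa using (ht (f.symm b)).symm
    · simpa using (hh (f.symm b)).symm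
  nonempty := hG.nonempty
  connected u v := (hG.connected u v).congr f fun a _ => ⟨trivial, ht a, hh a⟩

/-- Moving the head of an arc of a tree within its connected component, in the graph without this
arc, yields a tree. -/
theorem IsTree.redirect {G' : ArcGraph V E} (hG : G.IsTree) (j : E) (ht : G'.tail = G.tail)
    (hh : ∀ a, a ≠ j → G'.head a = G.head a)
    (hj : G.Linked (· ≠ j) (G.head j) (G'.head j)) : G'.IsTree := by
  have hsame : ∀ {P : E → Prop} {u v}, (∀ a, P a → a ≠ j) → G'.Linked P u v → G.Linked P u v :=
    fun hP h => h.congr id fun a ha => ⟨ha, by simp [ht], (hh a (hP a ha)).symm⟩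
  have hsame' : ∀ {P : E → Prop} {u v}, (∀ a, P a → a ≠ j) → G.Linked P u v → G'.Linked P u v :=
    fun hP h => h.congr id fun a ha => ⟨ha, by simp [ht], hh a (hP a ha)⟩
  have hbridge : ¬ G.Linked (· ≠ j) (G.tail j) (G'.head j) := fun h =>
    hG.bridge j (h.trans hj.symm)
  refine ⟨fun a h => ?_, hG.nonempty, fun u v => ?_⟩
  · by_cases ha : a = j
    · subst ha
      rw [ht] at h
      exact hbridge (hsame (fun _ h => h) h)
    · have hQ : ∀ b, b ≠ a → b = j ∨ (b ≠ a ∧ b ≠ j) := by grind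
      have hto : ∀ {u v}, G'.Linked (fun b => b ≠ a ∧ b ≠ j) u v → G.Linked (· ≠ j) u v :=
        fun h => (hsame (fun _ h => h.2) h).mono fun _ h => h.2
      have harc : G.Linked (· ≠ j) (G'.tail a) (G'.head a) := by
        rw [ht, hh a ha]; exact Linked.of_arc ha
      -- If the connection crosses the moved arc `j`, its two remaining pieces together with `a`
      -- join the ends of `j` without `j`, against `hbridge`.
      rcases h.of_insert hQ with h | ⟨h, h'⟩ | ⟨h, h'⟩
      · rw [ht, hh a ha] at h
        exact hG.bridge a ((hsame (fun _ h => h.2) h).mono fun _ h => h.1)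
      · rw [ht] at h
        exact hbridge (((hto h).symm.trans (ht ▸ harc)).trans (hto h').symm)
      · have := ((hto h').trans harc.symm).trans (hto h)
        rw [ht] at this
        exact hbridge this
  · refine (hG.connected u v).lift id fun a _ => ?_
    by_cases ha : a = j
    · subst ha
      have h₁ := Linked.of_arc (G := G') (P := fun _ => True) (a := a) trivial
      rw [ht] at h₁
      exact h₁.trans ((hsame' (fun _ h => h) hj).mono fun _ _ => trivial).symm
    · have h₁ := Linked.of_arc (G := G') (P := fun _ => True) (a := a) trivial
      rwa [ht, hh a ha] at h₁

end ArcGraph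

/-! ### Switching graphs with a total jump function. -/

namespace ProofStructure

variable {N A : Type*} (R : ProofStructure N A)

/-- The switching graph of `R` for `φ`, when the jumps of `R` are replaced by the total jump
function `J`. -/
noncomputable def wiring (J : {n // R.label n = .bot} → N) (φ : R.Switching) :
    ArcGraph (N ⊕ {n // R.label n = .par}) (A ⊕ {n // R.label n = .bot}) where
  tail := Sum.elim (fun a => Sum.inl (R.tail a)) (fun n => Sum.inl n.1)
  head := Sum.elim (R.switchedHead φ) (fun n => Sum.inl (J n))

/-- All the switching graphs of `R` with total jump function `J` are trees. -/
def CorrectWiring (J : {n // R.label n = .bot} → N) : Prop := ∀ φ, (R.wiring J φ).IsTree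

variable {R}

theorem exists_switching : Nonempty R.Switching := by
  refine ⟨⟨fun n => R.left ⟨n.1, Or.inr n.2⟩, fun n => R.head_left _⟩⟩

open Classical in
/-- The switching which chooses `a` at the `⅋` node below `a`, and agrees with `φ` elsewhere. -/
noncomputable def Switching.set (φ : R.Switching) (a : A) : R.Switching where
  choice n := if R.head a = n.1 then a else φ.choice n
  head_choice n := by
    split_ifs with h
    · exact h
    · exact φ.head_choice n

theorem Switching.set_choice (φ : R.Switching) {a : A} {x : {n // R.label n = .par}}
    (h : R.head a = x) : (φ.set a).choice x = a := by
  simp [Switching.set, h]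

theorem switchedHead_of_ne_par {φ : R.Switching} {a : A} (h : R.label (R.head a) ≠ .par) :
    R.switchedHead φ a = Sum.inl (R.head a) := by
  simp [switchedHead, h]

theorem switchedHead_of_choice {φ : R.Switching} {a : A} {x : {n // R.label n = .par}}
    (hx : R.head a = x) (h : φ.choice x = a) : R.switchedHead φ a = Sum.inl x.1 := by
  obtain ⟨x, hp⟩ := x
  subst hx
  simp [switchedHead, h, hp]

theorem switchedHead_of_choice_ne {φ : R.Switching} {a : A} {x : {n // R.label n = .par}}
    (hx : R.head a = x) (h : φ.choice x ≠ a) : R.switchedHead φ a = Sum.inr x := by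
  obtain ⟨x, hp⟩ := x
  subst hx
  simp [switchedHead, h, hp]

theorem head_of_switchedHead_inl {φ : R.Switching} {a : A} {v : N}
    (h : R.switchedHead φ a = Sum.inl v) : R.head a = v := by
  unfold switchedHead at h
  split_ifs at h <;> simpa using h

theorem choice_of_switchedHead_inl {φ : R.Switching} {a : A} {x : {n // R.label n = .par}}
    (h : R.switchedHead φ a = Sum.inl x.1) : φ.choice x = a := by
  by_contra hne
  rw [switchedHead_of_choice_ne (head_of_switchedHead_inl h) hne] at h
  cases h

theorem of_switchedHead_inr {φ : R.Switching} {a : A} {x : {n // R.label n = .par}}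
    (h : R.switchedHead φ a = Sum.inr x) : R.head a = x ∧ φ.choice x ≠ a := by
  by_cases hp : R.label (R.head a) = .par
  · by_cases hc : φ.choice ⟨R.head a, hp⟩ = a
    · rw [switchedHead_of_choice rfl hc] at h
      cases h
    · rw [switchedHead_of_choice_ne rfl hc] at h
      cases h
      exact ⟨rfl, hc⟩
  · rw [switchedHead_of_ne_par hp] at h
    cases h

theorem switchedHead_set {φ : R.Switching} {a b : A} (h : R.head b ≠ R.head a) :
    R.switchedHead (φ.set a) b = R.switchedHead φ b := by
  by_cases hp : R.label (R.head b) = .par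
  · have : (φ.set a).choice ⟨R.head b, hp⟩ = φ.choice ⟨R.head b, hp⟩ := by
      simp [Switching.set, h.symm]
    by_cases hc : φ.choice ⟨R.head b, hp⟩ = b
    · rw [switchedHead_of_choice rfl (this.trans hc), switchedHead_of_choice rfl hc]
    · rw [switchedHead_of_choice_ne rfl (this ▸ hc), switchedHead_of_choice_ne rfl hc]
  · rw [switchedHead_of_ne_par hp, switchedHead_of_ne_par hp]

theorem premise_cases {n : N} (h : (R.label n).numPremises = 2) {a b c : A} (hab : a ≠ b)
    (ha : R.head a = n) (hb : R.head b = n) (hc : R.head c = n) : c = a ∨ c = b := by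
  have hcard := R.card_premises n
  rw [h] at hcard
  obtain ⟨x, y, hxy, hs⟩ := Set.encard_eq_two.1 (by exact_mod_cast hcard)
  have key : ∀ d, R.head d = n → d = x ∨ d = y := fun d hd => by
    have : d ∈ {a | R.head a = n} := hd
    rw [hs] at this
    simpa using this
  have := key a ha
  have := key b hb
  have := key c hc
  grind

theorem premise_unique {n : N} (h : (R.label n).numPremises ≤ 1) {a b : A}
    (ha : R.head a = n) (hb : R.head b = n) : a = b := by
  have hcard := R.card_premises n
  have : {a | R.head a = n}.encard ≤ 1 := by rw [hcard]; exact_mod_cast h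
  exact Set.encard_le_one_iff.1 this a b ha hb

theorem no_premise {n : N} (h : (R.label n).numPremises = 0) (a : A) : R.head a ≠ n := by
  intro ha
  have hcard := R.card_premises n
  rw [h] at hcard
  have : {a | R.head a = n} = ∅ := Set.encard_eq_zero.1 (by exact_mod_cast hcard)
  exact (this ▸ (show a ∈ {a | R.head a = n} from ha) : a ∈ (∅ : Set A))

theorem exists_premise {n : N} (h : (R.label n).numPremises ≠ 0) : ∃ a, R.head a = n := by
  have hcard := R.card_premises n
  have : {a | R.head a = n}.encard ≠ 0 := by rw [hcard]; exact_mod_cast h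
  exact Set.encard_ne_zero.1 this

theorem exists_conclusion {n : N} (h : (R.label n).numConclusions ≠ 0) : ∃ a, R.tail a = n := by
  have hcard := R.card_conclusions n
  have : {a | R.tail a = n}.encard ≠ 0 := by rw [hcard]; exact_mod_cast h
  exact Set.encard_ne_zero.1 this

theorem conclusion_unique {n : N} (h : (R.label n).numConclusions ≤ 1) {a b : A}
    (ha : R.tail a = n) (hb : R.tail b = n) : a = b := by
  have hcard := R.card_conclusions n
  have : {a | R.tail a = n}.encard ≤ 1 := by rw [hcard]; exact_mod_cast h
  exact Set.encard_le_one_iff.1 this a b ha hb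

theorem Erasing.label {n : N} (h : R.Erasing n) :
    R.label n = .bot ∨ R.label n = .par ∨ R.label n = .bullet := by
  cases h with | intro _ h _ => exact h

theorem Erasing.tail {a : A} (h : R.Erasing (R.head a)) : R.Erasing (R.tail a) := by
  cases h with | intro _ _ h => exact h a rfl

theorem Erasing.conclusion_unique {n : N} (h : R.Erasing n) {a b : A}
    (ha : R.tail a = n) (hb : R.tail b = n) : a = b := by
  refine ProofStructure.conclusion_unique (n := n) ?_ ha hb
  rcases h.label with h | h | h <;> simp [h, NodeLabel.numConclusions]

open Classical in
theorem CorrectWiring.redirect {J : {n // R.label n = .bot} → N} (hJ : R.CorrectWiring J)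
    (n : {n // R.label n = .bot}) (t : N)
    (h : ∀ φ, (R.wiring J φ).Linked (· ≠ Sum.inr n) (Sum.inl (J n)) (Sum.inl t)) :
    R.CorrectWiring (Function.update J n t) := by
  intro φ
  refine (hJ φ).redirect (Sum.inr n) rfl ?_ ?_
  · rintro (a | n') hn
    · rfl
    · have : n' ≠ n := fun h => hn (by rw [h])
      simp [wiring, this]
  · simpa [wiring] using h φ

/-- The arcs of a switching graph, jumps included, which are not premises of `x` in `R`. -/
def OffNode (R : ProofStructure N A) (x : N) : A ⊕ {n // R.label n = .bot} → Prop :=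
  Sum.elim (fun a => R.head a ≠ x) fun _ => True

/-- Changing the choice at one ⅋ moves only the premises of that ⅋. -/
theorem linked_offNode_set {J : {n // R.label n = .bot} → N} {φ : R.Switching} {a : A}
    {u v : N ⊕ {n // R.label n = .par}}
    (h : (R.wiring J φ).Linked (R.OffNode (R.head a)) u v) :
    (R.wiring J (φ.set a)).Linked (R.OffNode (R.head a)) u v := by
  refine h.congr id ?_
  rintro (b | n) hb
  · exact ⟨hb, rfl, switchedHead_set hb⟩
  · exact ⟨hb, rfl, rfl⟩

/-! ### Connections between the premises of a ⅋ node. -/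

section Par

variable {J : {n // R.label n = .bot} → N} (hJ : R.CorrectWiring J) {φ : R.Switching}
  {x : {n // R.label n = .par}}
include hJ

theorem CorrectWiring.not_linked_choice :
    ¬ (R.wiring J φ).Linked (R.OffNode x) (Sum.inl (R.tail (φ.choice x))) (Sum.inl x.1) := by
  intro h
  apply (hJ φ).bridge (Sum.inl (φ.choice x))
  have h₁ : (R.wiring J φ).head (Sum.inl (φ.choice x)) = Sum.inl x.1 :=
    switchedHead_of_choice (φ.head_choice x) rfl
  rw [h₁]
  refine h.mono ?_
  rintro b hb rfl
  exact hb (φ.head_choice x)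

/-- Switching the choice to `a` keeps any connection off `x`, so the case of the chosen premise
applies. -/
theorem CorrectWiring.not_linked_premise {a : A} (ha : R.head a = x) :
    ¬ (R.wiring J φ).Linked (R.OffNode x) (Sum.inl (R.tail a)) (Sum.inl x.1) := by
  intro h
  have h₁ := hJ.not_linked_choice (φ := φ.set a) (x := x)
  rw [Switching.set_choice φ ha] at h₁
  rw [← ha] at h h₁
  exact h₁ (linked_offNode_set h)

open Classical in
/-- In each switching graph, the premises of a `⅋` node are connected without passing through the
premises of this node. -/
theorem CorrectWiring.linked_premises {a : A} (ha : R.head a = x) (hne : φ.choice x ≠ a) :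
    (R.wiring J φ).Linked (R.OffNode x) (Sum.inl (R.tail (φ.choice x))) (Sum.inl (R.tail a)) := by
  let c := φ.choice x
  have hc : R.head c = x := φ.head_choice x
  have hhc : (R.wiring J φ).head (Sum.inl c) = Sum.inl x.1 := switchedHead_of_choice hc rfl
  -- Gluing the fresh • of `x` to the tail of `a` makes the non-chosen premise `a` trivial, leaving
  -- `c` as the only premise of `x` in use. A connection crossing `c` would then join a premise to
  -- `x` off `x`.
  let r : N ⊕ {n // R.label n = .par} → N ⊕ {n // R.label n = .par} :=
    Sum.elim Sum.inl fun y => if y = x then Sum.inl (R.tail a) else Sum.inr y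
  have h : (R.wiring J φ).Linked (fun b => b = Sum.inl c ∨ R.OffNode x b)
      (r (Sum.inl (R.tail c))) (r (Sum.inl (R.tail a))) := by
    refine ((hJ φ).connected _ _).lift r ?_
    rintro (b | n) -
    · by_cases hb : R.head b = x
      · rcases premise_cases (by simp [x.2, NodeLabel.numPremises]) hne hc ha hb with rfl | rfl
        · have h₁ := ArcGraph.Linked.of_arc (G := R.wiring J φ) (a := Sum.inl c)
            (P := fun b => b = Sum.inl c ∨ R.OffNode x b) (Or.inl rfl)
          rw [hhc] at h₁ ⊢
          exact h₁
        · have h₁ : (R.wiring J φ).head (Sum.inl b) = Sum.inr x :=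
            switchedHead_of_choice_ne hb hne
          rw [h₁]
          simp only [r, wiring, Sum.elim_inl, Sum.elim_inr, if_true]
          exact .refl _
      · have h₁ := ArcGraph.Linked.of_arc (G := R.wiring J φ) (a := Sum.inl b)
          (P := fun b => b = Sum.inl c ∨ R.OffNode x b) (Or.inr hb)
        have h₂ : r ((R.wiring J φ).head (Sum.inl b)) = (R.wiring J φ).head (Sum.inl b) := by
          rcases hv : (R.wiring J φ).head (Sum.inl b) with v | y
          · rfl
          · have : y ≠ x := by
              rintro rfl
              exact hb (of_switchedHead_inr hv).1
            simp [r, this]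
        rw [h₂]
        exact h₁
    · exact ArcGraph.Linked.of_arc (G := R.wiring J φ) (a := Sum.inr n) (Or.inr trivial)
  rcases h.of_insert (fun _ h => h) with h | ⟨-, h⟩ | ⟨h, -⟩
  · exact h
  · rw [hhc] at h
    exact absurd h.symm (hJ.not_linked_premise ha)
  · rw [hhc] at h
    exact absurd h hJ.not_linked_choice

end Par

/-! ### Elementary redirections of one jump. -/

section Retarget

variable {J : {n // R.label n = .bot} → N} (hJ : R.CorrectWiring J) {n : {n // R.label n = .bot}}
include hJ

open Classical in
/-- A jump to a `⅋` or `•` node can be redirected to the node above. -/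
theorem CorrectWiring.update_premise {a : A} (ha : R.head a = J n) :
    R.CorrectWiring (Function.update J n (R.tail a)) := by
  refine hJ.redirect n _ fun φ => ?_
  have harc : ∀ b : A, (R.wiring J φ).Linked (· ≠ Sum.inr n) (Sum.inl (R.tail b))
      (R.switchedHead φ b) := fun b =>
    ArcGraph.Linked.of_arc (G := R.wiring J φ) (a := Sum.inl b) (by simp)
  by_cases hp : R.label (J n) = .par
  · let x : {n // R.label n = .par} := ⟨J n, hp⟩
    by_cases hc : φ.choice x = a
    · have := harc a
      rw [switchedHead_of_choice (x := x) ha hc] at this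
      exact this.symm
    · have h₁ := harc (φ.choice x)
      rw [switchedHead_of_choice (φ.head_choice x) rfl] at h₁
      have h₂ := hJ.linked_premises (x := x) ha hc
      -- The connection between the premises cannot use the jump from `n`: that jump ends at `x`,
      -- which is not reachable from a premise off `x`.
      rcases h₂.of_insert (e := Sum.inr n) (Q := fun b => R.OffNode x b ∧ b ≠ Sum.inr n)
        (by grind) with h | ⟨-, h⟩ | ⟨h, -⟩
      · exact h₁.symm.trans (h.mono fun _ h => h.2)
      · exact absurd (h.mono fun _ h => h.1).symm (hJ.not_linked_premise (x := x) ha)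
      · exact absurd (h.mono fun _ h => h.1) (hJ.not_linked_choice (x := x))
  · have := harc a
    rw [switchedHead_of_ne_par (ha ▸ hp), ha] at this
    exact this.symm

open Classical in
/-- A jump to a `⊥` node can be redirected to the target of the jump of the latter. -/
theorem CorrectWiring.update_bot {n' : {n // R.label n = .bot}} (h : J n = n') :
    R.CorrectWiring (Function.update J n (J n')) := by
  refine hJ.redirect n _ fun φ => ?_
  have hne : n' ≠ n := by
    rintro rfl
    apply (hJ φ).bridge (Sum.inr n')
    simp only [wiring, Sum.elim_inr, h]
    exact .refl _
  rw [h]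
  exact ArcGraph.Linked.of_arc (G := R.wiring J φ) (a := Sum.inr n') (by simpa using hne)

/-- The jumps between `⊥` nodes form no cycle. -/
theorem CorrectWiring.exists_jump_ne_bot (S : Set {n // R.label n = .bot}) (hS : S.Nonempty) :
    ∃ n ∈ S, ∀ n' ∈ S, J n ≠ n' := by
  by_contra! hcon
  choose! g hgS hg using hcon
  obtain ⟨φ⟩ := R.exists_switching
  have := R.finite_nodes
  obtain ⟨s, hs⟩ := hS
  have hmem : ∀ k, g^[k] s ∈ S := by
    intro k
    induction k with
    | zero => exact hs
    | succ k ih => rw [Function.iterate_succ_apply']; exact hgS _ ih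
  obtain ⟨i, j, hij, heq⟩ : ∃ i j, i < j ∧ g^[i] s = g^[j] s := by
    obtain ⟨i, j, hij, heq⟩ := Finite.exists_ne_map_eq_of_infinite fun k => g^[k] s
    rcases lt_or_gt_of_ne hij with h | h
    · exact ⟨i, j, h, heq⟩
    · exact ⟨j, i, h, heq.symm⟩
  set p := g^[i] s with hp
  have hpS : ∀ k, g^[k] p ∈ S := fun k => by
    rw [hp, ← Function.iterate_add_apply]; exact hmem _
  have hper : p ∈ Function.periodicPts g := by
    refine ⟨j - i, by omega, ?_⟩
    rw [Function.IsPeriodicPt, Function.IsFixedPt, hp, ← Function.iterate_add_apply,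
      Nat.sub_add_cancel hij.le, ← heq]
  have hpos := Function.minimalPeriod_pos_of_mem_periodicPts hper
  have hlink : ∀ k, 1 ≤ k → k ≤ Function.minimalPeriod g p →
      (R.wiring J φ).Linked (· ≠ Sum.inr p) (Sum.inl (g p).1) (Sum.inl (g^[k] p).1) := by
    intro k hk
    induction k, hk using Nat.le_induction with
    | base => intro _; exact .refl _
    | succ k hk ih =>
      intro hle
      refine (ih (by omega)).trans ?_
      -- Taking the minimal period ensures that the jumps after the first differ from the jump of
      -- `p`, so they close a cycle around it.
      have hne : g^[k] p ≠ p := fun h =>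
        Function.not_isPeriodicPt_of_pos_of_lt_minimalPeriod (by omega) (by omega) h
      have := ArcGraph.Linked.of_arc (G := R.wiring J φ) (a := Sum.inr (g^[k] p))
        (P := (· ≠ Sum.inr p)) (by simpa using hne)
      simpa only [wiring, Sum.elim_inr, hg _ (hpS k), Function.iterate_succ_apply'] using this
  have h₁ := hlink _ hpos le_rfl
  rw [Function.iterate_minimalPeriod] at h₁
  apply (hJ φ).bridge (Sum.inr p)
  simpa only [wiring, Sum.elim_inr, hg _ (hpS 0), Function.iterate_zero_apply, id,
    show J p = g p from hg _ (hpS 0)] using h₁.symm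

end Retarget

end ProofStructure

/-! ### Clearing all jumps off the erasing nodes. -/

namespace ProofStructure

variable {N A : Type*} {R : ProofStructure N A}

theorem Erasing.bot (n : {n // R.label n = .bot}) : R.Erasing n.1 :=
  .intro _ (Or.inl n.2) fun a ha =>
    absurd ha (no_premise (by simp [n.2, NodeLabel.numPremises]) a)

open Classical in
/-- Sequences of redirections of one jump, through correct jump functions. -/
def Rewires (R : ProofStructure N A) :
    ({n // R.label n = .bot} → N) → ({n // R.label n = .bot} → N) → Prop :=
  Relation.ReflTransGen fun J J' =>
    R.CorrectWiring J ∧ R.CorrectWiring J' ∧ ∃ n t, J' = Function.update J n t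

open Classical in
theorem CorrectWiring.rewires {J : {n // R.label n = .bot} → N} (hJ : R.CorrectWiring J)
    {n : {n // R.label n = .bot}} {t : N} (h : R.CorrectWiring (Function.update J n t)) :
    R.Rewires J (Function.update J n t) :=
  Relation.ReflTransGen.single ⟨hJ, h, n, t, rfl⟩

theorem Rewires.correctWiring {J J' : {n // R.label n = .bot} → N} (hJ : R.CorrectWiring J)
    (h : R.Rewires J J') : R.CorrectWiring J' := by
  cases h with
  | refl => exact hJ
  | tail _ h => exact h.2.1

open Classical in
/-- A jump to an erasing node can be redirected to a `⊥` node. -/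
theorem Erasing.exists_rewires_bot {q : N} (hq : R.Erasing q) (n : {n // R.label n = .bot}) :
    ∀ J : {n // R.label n = .bot} → N, R.CorrectWiring J → J n = q →
      ∃ n' : {n // R.label n = .bot}, R.Rewires J (Function.update J n n'.1) := by
  induction hq with
  | intro q hlabel _ ih =>
    intro J hJ hn
    by_cases hb : R.label q = .bot
    · refine ⟨⟨q, hb⟩, ?_⟩
      have : Function.update J n q = J := by rw [← hn, Function.update_eq_self]
      rw [this]
      exact .refl
    · obtain ⟨a, ha⟩ := R.exists_premise (n := q) (by
        rcases hlabel with h | h | h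
        · exact absurd h hb
        all_goals simp [h, NodeLabel.numPremises])
      have hJ' := hJ.update_premise (ha.trans hn.symm)
      obtain ⟨n', h⟩ := ih a ha _ hJ' (Function.update_self _ _ _)
      rw [Function.update_idem] at h
      exact ⟨n', (hJ.rewires hJ').trans h⟩

theorem CorrectWiring.exists_rewires_erasing_bot {J : {n // R.label n = .bot} → N}
    (hJ : R.CorrectWiring J) :
    ∃ J', R.Rewires J J' ∧ ∀ n, R.Erasing (J' n) → R.label (J' n) = .bot := by
  classical
  have := R.finite_nodes
  have := Fintype.ofFinite {n // R.label n = .bot}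
  suffices h : ∀ s : Finset {n // R.label n = .bot}, ∃ J', R.Rewires J J' ∧
      ∀ n ∈ s, R.Erasing (J' n) → R.label (J' n) = .bot by
    simpa using h Finset.univ
  intro s
  induction s using Finset.induction_on with
  | empty => exact ⟨J, .refl, by simp⟩
  | insert n s _ ih =>
    obtain ⟨J', hr, hs⟩ := ih
    by_cases hn : R.Erasing (J' n)
    · obtain ⟨n', h⟩ := hn.exists_rewires_bot n J' (hr.correctWiring hJ) rfl
      refine ⟨_, hr.trans h, fun k hk hke => ?_⟩
      by_cases hkn : k = n
      · subst hkn
        simpa using n'.2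
      · rw [Function.update_of_ne hkn] at hke ⊢
        exact hs k ((Finset.mem_insert.1 hk).resolve_left hkn) hke
    · refine ⟨J', hr, fun k hk hke => ?_⟩
      rcases Finset.mem_insert.1 hk with rfl | hk
      · exact absurd hke hn
      · exact hs k hk hke

/-- All the jumps to erasing nodes can be redirected to non-erasing nodes. -/
theorem CorrectWiring.exists_rewires_not_erasing {J : {n // R.label n = .bot} → N}
    (hJ : R.CorrectWiring J) : ∃ J', R.Rewires J J' ∧ ∀ n, ¬ R.Erasing (J' n) := by
  classical
  have := R.finite_nodes
  suffices h : ∀ k, ∀ J, R.CorrectWiring J → (∀ n, R.Erasing (J n) → R.label (J n) = .bot) →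
      {n | R.label (J n) = .bot}.ncard ≤ k → ∃ J', R.Rewires J J' ∧ ∀ n, ¬ R.Erasing (J' n) by
    obtain ⟨J₁, hr, h₁⟩ := hJ.exists_rewires_erasing_bot
    obtain ⟨J₂, hr', h₂⟩ := h _ J₁ (hr.correctWiring hJ) h₁ le_rfl
    exact ⟨J₂, hr.trans hr', h₂⟩
  intro k
  induction k with
  | zero =>
    intro J _ hb hk
    refine ⟨J, .refl, fun n hn => ?_⟩
    have h0 : {n | R.label (J n) = .bot} = ∅ :=
      (Set.ncard_eq_zero (Set.toFinite _)).1 (Nat.le_zero.1 hk)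
    exact (h0 ▸ (show n ∈ {n | R.label (J n) = .bot} from hb n hn) :
      n ∈ (∅ : Set {n // R.label n = .bot}))
  | succ k ih =>
    intro J hJ hb hk
    by_cases hS : {n | R.label (J n) = .bot}.Nonempty
    -- The target of `n` is a ⊥ whose own jump leaves the ⊥ nodes; redirecting `n` along it lowers
    -- the number of ⊥-to-⊥ jumps.
    · obtain ⟨n, hn, hn'⟩ := hJ.exists_jump_ne_bot _ hS
      have hJ' := hJ.update_bot (n := n) (n' := ⟨J n, hn⟩) rfl
      have ht : R.label (J ⟨J n, hn⟩) ≠ .bot := fun h => hn' ⟨J n, hn⟩ h rfl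
      obtain ⟨J', hr, h'⟩ := ih _ hJ' (fun m hm => by
        by_cases hmn : m = n
        · subst hmn
          rw [Function.update_self] at hm ⊢
          exact hb _ hm
        · rw [Function.update_of_ne hmn] at hm ⊢
          exact hb _ hm) (by
        refine Nat.lt_succ_iff.1 (lt_of_lt_of_le (Set.ncard_lt_ncard ?_ (Set.toFinite _)) hk)
        refine ⟨fun m hm => ?_, fun hsub => ?_⟩
        · by_cases hmn : m = n
          · rw [hmn]; exact hn
          · simpa [hmn] using hm
        · have := hsub hn
          simp [ht] at this)
      exact ⟨J', (hJ.rewires hJ').trans hr, h'⟩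
    · exact ⟨J, .refl, fun n hn => hS ⟨n, hb n hn⟩⟩

/-- There are non-erasing nodes. -/
theorem CorrectWiring.exists_not_erasing {J : {n // R.label n = .bot} → N}
    (hJ : R.CorrectWiring J) : ∃ m, ¬ R.Erasing m := by
  by_contra! hall
  obtain ⟨J', -, hJ'⟩ := hJ.exists_rewires_not_erasing
  have hno : ∀ m, R.Erasing m → False := by
    intro m hm
    induction hm with
    | intro q hlabel _ ih =>
      by_cases hb : R.label q = .bot
      · exact hJ' ⟨q, hb⟩ (hall _)
      · obtain ⟨a, ha⟩ := R.exists_premise (n := q) (by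
          rcases hlabel with h | h | h
          · exact absurd h hb
          all_goals simp [h, NodeLabel.numPremises])
        exact ih a ha
  obtain ⟨φ⟩ := exists_switching (R := R)
  obtain ⟨m | m⟩ := (hJ φ).nonempty
  · exact hno m (hall m)
  · exact hno m.1 (hall m.1)

/-! ### The thread of erasing nodes below a ⊥ node. -/

/-- An arc from an erasing node to an erasing node. -/
def ErasingArrow (R : ProofStructure N A) (u v : N) : Prop :=
  R.toArcGraph.Arrow u v ∧ R.Erasing u ∧ R.Erasing v

/-- An arc of a switching graph, starting from an erasing node and not reaching a non-erasing
node. -/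
def ErasingFlow (φ : R.Switching) (u v : N ⊕ {n // R.label n = .par}) : Prop :=
  ∃ a, Sum.inl (R.tail a) = u ∧ R.switchedHead φ a = v ∧ R.Erasing (R.tail a) ∧
    ∀ y, v = Sum.inl y → R.Erasing y

/-- The nodes reached from `n` through erasing nodes in a switching graph. -/
def erasingFlow (φ : R.Switching) (n : {n // R.label n = .bot}) :
    Set (N ⊕ {n // R.label n = .par}) :=
  {v | Relation.ReflTransGen (ErasingFlow φ) (Sum.inl n.1) v}

section Flow

variable {φ : R.Switching} {n : {n // R.label n = .bot}}

theorem reflTransGen_of_mem_erasingFlow {v : N ⊕ {n // R.label n = .par}}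
    (hv : v ∈ erasingFlow φ n) :
    ∀ z, v = Sum.inl z → Relation.ReflTransGen R.ErasingArrow n.1 z := by
  induction hv with
  | refl => rintro z h; cases h; exact .refl
  | tail _ h ih =>
    obtain ⟨a, rfl, hs, he, hy⟩ := h
    intro z hz
    exact (ih _ rfl).tail ⟨⟨a, rfl, head_of_switchedHead_inl (hs.trans hz)⟩, he, hy z hz⟩

theorem erasing_of_mem_erasingFlow {z : N} (h : Sum.inl z ∈ erasingFlow φ n) : R.Erasing z := by
  cases reflTransGen_of_mem_erasingFlow h z rfl with
  | refl => exact .bot n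
  | tail _ h => exact h.2.2

theorem eq_of_mem_erasingFlow {n' : {n // R.label n = .bot}}
    (h : Sum.inl n'.1 ∈ erasingFlow φ n) : n' = n := by
  rcases Relation.ReflTransGen.cases_tail (reflTransGen_of_mem_erasingFlow h _ rfl) with h | h
  · exact Subtype.ext h
  · obtain ⟨_, -, ⟨a, -, ha⟩, -⟩ := h
    exact absurd ha (no_premise (by simp [n'.2, NodeLabel.numPremises]) a)

theorem erasingFlow_rightUnique : Relator.RightUnique (ErasingFlow φ) := by
  rintro u v w ⟨a, rfl, rfl, he, -⟩ ⟨b, hb, rfl, -⟩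
  rw [he.conclusion_unique rfl (Sum.inl_injective hb)]

/-- At most one arc leaves the nodes reached from `n` for a non-erasing node. -/
theorem eq_of_exits_erasingFlow {a b : A} {y z : N} (ha : Sum.inl (R.tail a) ∈ erasingFlow φ n)
    (hb : Sum.inl (R.tail b) ∈ erasingFlow φ n) (hay : R.switchedHead φ a = Sum.inl y)
    (hbz : R.switchedHead φ b = Sum.inl z) (hy : ¬ R.Erasing y) (hz : ¬ R.Erasing z) : a = b := by
  have key : ∀ {a b : A} {y : N}, Sum.inl (R.tail a) ∈ erasingFlow φ n →
      R.switchedHead φ a = Sum.inl y → ¬ R.Erasing y →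
      Relation.ReflTransGen (ErasingFlow φ) (Sum.inl (R.tail a)) (Sum.inl (R.tail b)) →
      a = b := by
    intro a b y ha hay hy h
    have he := erasing_of_mem_erasingFlow ha
    rcases Relation.ReflTransGen.cases_head h with h | ⟨w, ⟨d, hd, hw, -, hwy⟩, -⟩
    · exact he.conclusion_unique rfl (Sum.inl_injective h).symm
    · have : d = a := he.conclusion_unique (Sum.inl_injective hd) rfl
      subst this
      exact absurd (hwy y (hw.symm.trans hay)) hy
  rcases Relation.ReflTransGen.total_of_right_unique erasingFlow_rightUnique ha hb with h | h
  · exact key ha hay hy h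
  · exact (key hb hbz hz h).symm

/-- The conclusions of erasing nodes are premises of `⅋` and `•` nodes only. -/
def ErasingAbovePar (R : ProofStructure N A) : Prop :=
  ∀ a, R.Erasing (R.tail a) → R.label (R.head a) = .par ∨ R.label (R.head a) = .bullet

/-- Nothing joins the thread from above: in a switching graph a ⊥ has no premise, and an erasing ⅋,
a • or a fresh • has exactly one. -/
theorem tail_mem_erasingFlow {b : A}
    (h : R.switchedHead φ b ∈ erasingFlow φ n) : Sum.inl (R.tail b) ∈ erasingFlow φ n := by
  generalize hv : R.switchedHead φ b = v at h
  cases h with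
  | refl =>
    exact absurd (head_of_switchedHead_inl hv)
      (no_premise (by simp [n.2, NodeLabel.numPremises]) b)
  | tail hu h =>
    obtain ⟨a, rfl, hs, he, hy⟩ := h
    suffices hab : a = b by rw [← hab]; exact hu
    rcases v with y | y
    · have ha := head_of_switchedHead_inl hs
      have hb := head_of_switchedHead_inl hv
      rcases (hy y rfl).label with h | h | h
      · exact absurd ha (no_premise (by simp [h, NodeLabel.numPremises]) a)
      · exact (choice_of_switchedHead_inl (x := ⟨y, h⟩) hs).symm.trans
          (choice_of_switchedHead_inl (x := ⟨y, h⟩) hv)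
      · exact premise_unique (by simp [h, NodeLabel.numPremises]) ha hb
    · obtain ⟨ha, hac⟩ := of_switchedHead_inr hs
      obtain ⟨hb, hbc⟩ := of_switchedHead_inr hv
      exact ((premise_cases (by simp [y.2, NodeLabel.numPremises]) hac (φ.head_choice y) ha
        hb).resolve_left hbc.symm).symm

open Classical in
/-- Connections can avoid the nodes reached from `n`, if no other arc leaves these nodes. -/
theorem linked_avoid_erasingFlow {J : {n // R.label n = .bot} → N}
    (hJ : ∀ n, ¬ R.Erasing (J n)) {Q : A ⊕ {n // R.label n = .bot} → Prop}
    (hQ : ∀ b, Q (Sum.inl b) → Sum.inl (R.tail b) ∈ erasingFlow φ n →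
      ∀ y, R.switchedHead φ b = Sum.inl y → R.Erasing y)
    {u v : N ⊕ {n // R.label n = .par}} (h : (R.wiring J φ).Linked Q u v) :
    (R.wiring J φ).Linked (· ≠ Sum.inr n) (if u ∈ erasingFlow φ n then Sum.inl (J n) else u)
      (if v ∈ erasingFlow φ n then Sum.inl (J n) else v) := by
  -- Contracts the thread onto the target of `n`. The jump of `n` and the inner arcs become trivial,
  -- and no other arc in `Q` touches the thread, since all jumps land on non-erasing nodes.
  let r : N ⊕ {n // R.label n = .par} → N ⊕ {n // R.label n = .par} :=
    fun u => if u ∈ erasingFlow φ n then Sum.inl (J n) else u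
  have hr : ∀ {u}, u ∈ erasingFlow φ n → r u = Sum.inl (J n) := fun h => if_pos h
  have hr' : ∀ {u}, u ∉ erasingFlow φ n → r u = u := fun h => if_neg h
  refine h.lift r ?_
  rintro (b | n') hb
  · change (R.wiring J φ).Linked _ (r (Sum.inl (R.tail b))) (r (R.switchedHead φ b))
    by_cases ht : Sum.inl (R.tail b) ∈ erasingFlow φ n
    · have hh : R.switchedHead φ b ∈ erasingFlow φ n :=
        ht.tail ⟨b, rfl, rfl, erasing_of_mem_erasingFlow ht, hQ b hb ht⟩
      rw [hr ht, hr hh]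
      exact .refl _
    · rw [hr' ht, hr' fun hh => ht (tail_mem_erasingFlow hh)]
      exact ArcGraph.Linked.of_arc (G := R.wiring J φ) (a := Sum.inl b) (by simp)
  · change (R.wiring J φ).Linked _ (r (Sum.inl n'.1)) (r (Sum.inl (J n')))
    rw [hr' fun hh => hJ n' (erasing_of_mem_erasingFlow hh)]
    by_cases hn : n' = n
    · subst hn
      rw [hr (show Sum.inl n'.1 ∈ erasingFlow φ n' from .refl)]
      exact .refl _
    · rw [hr' fun hh => hn (eq_of_mem_erasingFlow hh)]
      exact ArcGraph.Linked.of_arc (G := R.wiring J φ) (a := Sum.inr n') (by simpa using hn)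

end Flow

open Classical in
/-- If all jumps reach non-erasing nodes, then the jump from `n` can be redirected to any
non-erasing node `t`, provided that `t` is above the first non-erasing node below `n`, if any. -/
theorem CorrectWiring.update_target {J : {n // R.label n = .bot} → N} (hJ : R.CorrectWiring J)
    (hR : R.ErasingAbovePar) (hne : ∀ n, ¬ R.Erasing (J n)) {n : {n // R.label n = .bot}} {t : N}
    (ht : ¬ R.Erasing t)
    (hcan : ∀ e y, Relation.ReflTransGen R.ErasingArrow n.1 e → R.Erasing e →
      R.toArcGraph.Arrow e y → R.label y = .par → ¬ R.Erasing y → R.toArcGraph.Arrow t y) :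
    R.CorrectWiring (Function.update J n t) := by
  refine hJ.redirect n t fun φ => ?_
  have hJn : Sum.inl (J n) ∉ erasingFlow φ n := fun h => hne n (erasing_of_mem_erasingFlow h)
  have htn : Sum.inl t ∉ erasingFlow φ n := fun h => ht (erasing_of_mem_erasingFlow h)
  by_cases hex : ∃ a y, Sum.inl (R.tail a) ∈ erasingFlow φ n ∧
      R.switchedHead φ a = Sum.inl y ∧ ¬ R.Erasing y
  · obtain ⟨a, y, ha, hay, hy⟩ := hex
    have hea := erasing_of_mem_erasingFlow ha
    have hhead := head_of_switchedHead_inl hay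
    have hp : R.label y = .par := by
      rcases hR a hea with h | h
      · rwa [hhead] at h
      · rw [hhead] at h
        refine absurd (Erasing.intro y (Or.inr (Or.inr h)) fun b hb => ?_) hy
        rwa [premise_unique (by simp [h, NodeLabel.numPremises]) hb hhead]
    obtain ⟨b, rfl, hby⟩ := hcan _ y (reflTransGen_of_mem_erasingFlow ha _ rfl) hea
      ⟨a, rfl, hhead⟩ hp hy
    have hc : φ.choice ⟨y, hp⟩ = a := choice_of_switchedHead_inl (x := ⟨y, hp⟩) hay
    have hab : φ.choice ⟨y, hp⟩ ≠ b := by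
      rw [hc]
      rintro rfl
      exact ht hea
    -- The only exit `a` is a premise of `y`, so working off `y` seals the thread; contraction moves
    -- the end at `R.tail a` to `J n`.
    have h := linked_avoid_erasingFlow (n := n) hne (Q := R.OffNode y) (fun d hd hdn z hz => by
      by_contra hze
      exact hd (by rw [← eq_of_exits_erasingFlow ha hdn hay hz hy hze, hhead]))
      (hJ.linked_premises (x := ⟨y, hp⟩) hby hab)
    rwa [hc, if_pos ha, if_neg htn] at h
  · have h := linked_avoid_erasingFlow (n := n) hne (Q := fun _ => True) (fun d _ hdn z hz => by
      by_contra hze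
      exact hex ⟨d, z, hdn, hz, hze⟩) ((hJ φ).connected (Sum.inl (J n)) (Sum.inl t))
    rwa [if_neg hJn, if_neg htn] at h

/-- Redirecting one ⊥ at a time to a non-erasing node preserves the invariant that `update_target`
needs. -/
theorem CorrectWiring.rewires_of_targets {J K : {n // R.label n = .bot} → N}
    (hJ : R.CorrectWiring J) (hR : R.ErasingAbovePar) (hK : ∀ n, ¬ R.Erasing (K n))
    (hcan : ∀ n e y, Relation.ReflTransGen R.ErasingArrow n.1 e → R.Erasing e →
      R.toArcGraph.Arrow e y → R.label y = .par → ¬ R.Erasing y →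
        R.toArcGraph.Arrow (K n) y) :
    R.Rewires J K := by
  classical
  have := R.finite_nodes
  have := Fintype.ofFinite {n // R.label n = .bot}
  suffices h : ∀ s : Finset {n // R.label n = .bot}, ∃ J', R.Rewires J J' ∧
      (∀ n, ¬ R.Erasing (J' n)) ∧ ∀ n ∈ s, J' n = K n by
    obtain ⟨J', hr, -, h⟩ := h Finset.univ
    rwa [show J' = K from funext fun n => h n (Finset.mem_univ n)] at hr
  intro s
  induction s using Finset.induction_on with
  | empty =>
    obtain ⟨J', hr, h⟩ := hJ.exists_rewires_not_erasing
    exact ⟨J', hr, h, by simp⟩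
  | insert n s _ ih =>
    obtain ⟨J', hr, hne, hs⟩ := ih
    have hJ' := hr.correctWiring hJ
    have hJ'' := hJ'.update_target hR hne (hK n) (hcan n)
    refine ⟨_, hr.trans (hJ'.rewires hJ''), fun k => ?_, fun k hk => ?_⟩
    · by_cases hkn : k = n
      · rw [hkn, Function.update_self]; exact hK n
      · rw [Function.update_of_ne hkn]; exact hne k
    · by_cases hkn : k = n
      · rw [hkn, Function.update_self]
      · rw [Function.update_of_ne hkn]
        exact hs k ((Finset.mem_insert.1 hk).resolve_left hkn)

end ProofStructure

/-! ### Canonical targets. -/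

namespace ProofStructure

variable {N A : Type*} {R : ProofStructure N A}

theorem ErasingAbovePar.label_eq_par (hR : R.ErasingAbovePar) {e y : N} (he : R.Erasing e)
    (hey : R.toArcGraph.Arrow e y) (hy : ¬ R.Erasing y) : R.label y = .par := by
  obtain ⟨a, rfl, rfl⟩ := hey
  refine (hR a he).resolve_right fun h => hy ?_
  refine .intro _ (Or.inr (Or.inr h)) fun b hb => ?_
  rwa [premise_unique (by simp [h, NodeLabel.numPremises]) hb rfl]

theorem exists_exit_of_transGen {u v : N} (h : Relation.TransGen R.toArcGraph.Arrow u v)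
    (hu : R.Erasing u) (hv : ¬ R.Erasing v) :
    ∃ e y, Relation.ReflTransGen R.ErasingArrow u e ∧ R.Erasing e ∧ R.toArcGraph.Arrow e y ∧
      ¬ R.Erasing y := by
  induction h using Relation.TransGen.head_induction_on with
  | single h => exact ⟨_, _, .refl, hu, h, hv⟩
  | @head u w h _ ih =>
    by_cases hw : R.Erasing w
    · obtain ⟨e, y, hue, h'⟩ := ih hw
      exact ⟨e, y, hue.head ⟨h, hu, hw⟩, h'⟩
    · exact ⟨_, _, .refl, hu, h, hw⟩

theorem Erasing.arrow_unique {e v w : N} (he : R.Erasing e) (hv : R.toArcGraph.Arrow e v)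
    (hw : R.toArcGraph.Arrow e w) : v = w := by
  obtain ⟨a, ha, rfl⟩ := hv
  obtain ⟨b, hb, rfl⟩ := hw
  rw [he.conclusion_unique ha hb]

/-- Erasing nodes have at most one conclusion, so the descent from `u` is forced to pass through
`e`. -/
theorem transGen_of_erasingArrow {u e v : N} (h : Relation.ReflTransGen R.ErasingArrow u e)
    (huv : Relation.TransGen R.toArcGraph.Arrow u v) (hv : ¬ R.Erasing v) :
    Relation.TransGen R.toArcGraph.Arrow e v := by
  induction h with
  | refl => exact huv
  | tail _ h ih =>
    obtain ⟨w, hw, hwv⟩ := Relation.TransGen.head'_iff.1 ih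
    have := h.2.1.arrow_unique hw h.1
    subst this
    rcases Relation.reflTransGen_iff_eq_or_transGen.1 hwv with rfl | h'
    · exact absurd h.2.2 hv
    · exact h'

/-- The first non-erasing node below a `⊥` node is the least non-erasing `⅋` node below it. -/
theorem isLeastNonErasingPar_of_exit {n e y : N}
    (h : Relation.ReflTransGen R.ErasingArrow n e) (he : R.Erasing e)
    (hey : R.toArcGraph.Arrow e y) (hp : R.label y = .par) (hy : ¬ R.Erasing y) :
    R.IsLeastNonErasingPar n y := by
  refine ⟨⟨hp, hy, ?_⟩, fun n₁ _ hn₁ hlt => ?_⟩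
  · exact Relation.TransGen.tail' (h.lift id fun _ _ h => h.1) hey
  · obtain ⟨w, hw, hwn⟩ := Relation.TransGen.head'_iff.1 (transGen_of_erasingArrow h hlt hn₁)
    rw [he.arrow_unique hw hey] at hwn
    exact Relation.reflTransGen_iff_eq_or_transGen.1 hwn

theorem IsLeastNonErasingPar.unique {n x y : N} (hx : R.IsLeastNonErasingPar n x)
    (hy : R.IsLeastNonErasingPar n y) : x = y := by
  by_contra hne
  have h₁ := (hx.2 y hy.1.1 hy.1.2.1 hy.1.2.2).resolve_left (Ne.symm hne)
  have h₂ := (hy.2 x hx.1.1 hx.1.2.1 hx.1.2.2).resolve_left hne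
  exact R.dag _ (h₁.trans h₂)

theorem exists_isCanonicalTarget (hR : R.ErasingAbovePar) {n : {n // R.label n = .bot}}
    (h : R.AboveNonErasingPar n) : ∃ n', R.IsCanonicalTarget n n' := by
  obtain ⟨n₀, -, hn₀, hlt⟩ := h
  obtain ⟨e, y, hne, he, hey, hy⟩ := exists_exit_of_transGen hlt (.bot n) hn₀
  have hp := hR.label_eq_par he hey hy
  have hex : ∃ a, R.head a = y ∧ ¬ R.Erasing (R.tail a) := by
    by_contra! hall
    exact hy (.intro y (Or.inr (Or.inl hp)) hall)
  obtain ⟨a, ha, hta⟩ := hex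
  exact ⟨R.tail a, hta, y, isLeastNonErasingPar_of_exit hne he hey hp hy, a, rfl, ha⟩

theorem exists_canonicalJumpExt_eq (hR : R.ErasingAbovePar) {m : N} (hm : ¬ R.Erasing m)
    (n : {n // R.label n = .bot}) :
    ∃ t, R.canonicalJumpExt m n = some t ∧ ¬ R.Erasing t ∧
      ∀ e y, Relation.ReflTransGen R.ErasingArrow n.1 e → R.Erasing e →
        R.toArcGraph.Arrow e y → R.label y = .par → ¬ R.Erasing y → R.toArcGraph.Arrow t y := by
  by_cases h : R.AboveNonErasingPar n
  · have hex := exists_isCanonicalTarget hR h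
    refine ⟨hex.choose, ?_, hex.choose_spec.1, fun e y hne he hey hp hy => ?_⟩
    · simp [canonicalJumpExt, canonicalJump, canonicalTarget, h, hex]
    · obtain ⟨n₀, hn₀, harr⟩ := hex.choose_spec.2
      rwa [hn₀.unique (isLeastNonErasingPar_of_exit hne he hey hp hy)] at harr
  · refine ⟨m, by simp [canonicalJumpExt, h], hm, fun e y hne he hey hp hy => absurd ?_ h⟩
    exact ⟨y, (isLeastNonErasingPar_of_exit hne he hey hp hy).1⟩

end ProofStructure

/-! ### Typing in the fragment and conclusion. -/

theorem MLLFormula.KindE.not_kindA {F : MLLFormula} (h : F.KindE) : ¬ F.KindA := by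
  induction h with
  | bot => intro h; cases h
  | par _ _ ih₁ ih₂ =>
    intro h
    cases h with
    | parAA h _ => exact ih₁ h
    | parAE h _ => exact ih₁ h
    | parEA _ h => exact ih₂ h

namespace TypedProofStructure

variable {N A : Type*} {R : TypedProofStructure N A}

theorem kindE_of_erasing {z : N} (h : R.Erasing z) :
    ∀ a, R.tail a = z → (R.type a).KindE := by
  induction h with
  | intro z hlabel _ ih =>
    rintro a rfl
    rcases hlabel with h | h | h
    · rw [R.type_bot a h]
      exact .bot
    · rw [R.type_par a h]
      exact .par (ih _ (R.head_left _) _ rfl) (ih _ (R.head_right _) _ rfl)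
    · have hcard := R.card_conclusions (R.tail a)
      rw [h] at hcard
      have h0 : {b | R.tail b = R.tail a} = ∅ :=
        Set.encard_eq_zero.1 (by exact_mod_cast hcard)
      exact (h0 ▸ (show a ∈ {b | R.tail b = R.tail a} from rfl) : a ∈ (∅ : Set A)).elim

/-- Conclusions of erasing nodes have kind E, whereas both sides of a ⊗ in the fragment have kind A,
and no formula has both kinds. -/
theorem erasingAbovePar (hcut : R.CutFree) (hF : R.InFragment MLLFormula.notBotTensorLL) :
    R.ErasingAbovePar := by
  intro a ha
  have hE := kindE_of_erasing ha a rfl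
  have hno := fun h => ProofStructure.no_premise (R := R.toProofStructure) (n := R.head a) h a rfl
  match hl : R.label (R.head a) with
  | .ax | .one | .bot => exact absurd (by simp [hl, NodeLabel.numPremises]) hno
  | .cut => exact absurd hl (hcut _)
  | .par => exact Or.inl rfl
  | .bullet => exact Or.inr rfl
  | .tensor =>
    exfalso
    obtain ⟨b, hb⟩ := ProofStructure.exists_conclusion (R := R.toProofStructure) (n := R.head a)
      (by simp [hl, NodeLabel.numConclusions])
    have hlb : R.label (R.tail b) = .tensor := by rw [hb, hl]
    have htype := R.type_tensor b hlb
    have hab := ProofStructure.premise_cases (R := R.toProofStructure) (n := R.tail b) (c := a)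
      (by simp [hlb, NodeLabel.numPremises]) (R.left_ne_right ⟨R.tail b, Or.inl hlb⟩)
      (R.head_left _) (R.head_right _) hb.symm
    have hk := hF b
    rw [htype] at hk
    rcases hk with hk | hk
    · cases hk with
      | tensor h₁ h₂ =>
        rcases hab with hab | hab
        · exact hE.not_kindA (hab ▸ h₁)
        · exact hE.not_kindA (hab ▸ h₂)
    · cases hk

theorem jumpCorrect_withJump_iff {J : {n // R.label n = .bot} → N} :
    (R.withJump fun n => some (J n)).JumpCorrect ↔ R.CorrectWiring J := by
  let f : A ⊕ {n // R.label n = .bot} ≃ A ⊕ {n : {n // R.label n = .bot} // (some (J n)).isSome} :=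
    Equiv.sumCongr (Equiv.refl A) (Equiv.subtypeUnivEquiv fun _ => rfl).symm
  constructor
  · rintro ⟨-, hac, hc⟩ φ
    have := ArcGraph.isTree_iff.2 ⟨hac ⟨φ.choice, φ.head_choice⟩, hc ⟨φ.choice, φ.head_choice⟩⟩
    refine this.of_equiv f.symm ?_ ?_
    · rintro (a | n) <;> rfl
    · rintro (a | n) <;> rfl
  · intro h
    have key : ∀ φ : (R.withJump fun n => some (J n)).Switching,
        ((R.withJump fun n => some (J n)).switchingGraph φ).IsTree := fun φ => by
      refine (h ⟨φ.choice, φ.head_choice⟩).of_equiv f ?_ ?_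
      · rintro (a | n) <;> rfl
      · rintro (a | n) <;> rfl
    exact ⟨fun _ => rfl, fun φ => (ArcGraph.isTree_iff.1 (key φ)).1,
      fun φ => (ArcGraph.isTree_iff.1 (key φ)).2⟩

open Classical in
theorem rewiringEquiv_of_rewires {J J' : {n // R.label n = .bot} → N}
    (hJ : R.CorrectWiring J) (h : R.Rewires J J') :
    ∃ hJ' : R.CorrectWiring J', RewiringEquiv
      ⟨R.withJump fun n => some (J n), jumpCorrect_withJump_iff.2 hJ⟩
      ⟨R.withJump fun n => some (J' n), jumpCorrect_withJump_iff.2 hJ'⟩ := by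
  induction h with
  | refl => exact ⟨hJ, .refl _⟩
  | @tail J₁ J₂ _ h ih =>
    obtain ⟨h₁, hequiv⟩ := ih
    obtain ⟨-, h₂, n, t, rfl⟩ := h
    refine ⟨h₂, hequiv.trans _ _ _ ?_⟩
    -- `Rewires` allows updates that change nothing, but `Redirect` does not; such steps are
    -- absorbed by reflexivity.
    by_cases ht : t = J₁ n
    · subst ht
      simp only [Function.update_eq_self]
      exact .refl _
    · refine .rel _ _ ⟨n, J₁ n, t, rfl, ht, ?_⟩
      change R.withJump _ = R.withJump _
      congr 1
      funext k
      exact Function.apply_update (fun _ => some) J₁ n t k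

theorem erasing_underlyingJumpFree {n : N} (h : R.underlyingJumpFree.Erasing n) :
    R.Erasing n := by
  induction h with
  | intro n hlabel _ ih => exact .intro n hlabel ih

/-- Presents `R` over its jump-free version, on which the canonical jumps are computed. -/
theorem eq_withJump_of_jumpTotal (h : R.JumpTotal) :
    ∃ J : {n // R.underlyingJumpFree.label n = .bot} → N,
      R = R.underlyingJumpFree.withJump fun n => some (J n) := by
  refine ⟨fun n => (R.jump n).get (h n), ?_⟩
  have : R.jump = fun n => some ((R.jump n).get (h n)) := by
    funext n
    simp
  exact congrArg R.withJump this

theorem exists_rewiringEquiv_canonicalJumpVersion (hR : R.JumpCorrect) (hcut : R.CutFree)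
    (hF : R.InFragment MLLFormula.notBotTensorLL) {m : N}
    (hm : ¬ R.underlyingJumpFree.Erasing m) :
    ∃ hm : (R.canonicalJumpVersion m).JumpCorrect,
      RewiringEquiv ⟨R, hR⟩ ⟨R.canonicalJumpVersion m, hm⟩ := by
  obtain ⟨J, hJ⟩ := eq_withJump_of_jumpTotal hR.1
  have hab : R.underlyingJumpFree.ErasingAbovePar := erasingAbovePar hcut hF
  choose K hK hne hcan using ProofStructure.exists_canonicalJumpExt_eq hab hm
  have hcor : R.underlyingJumpFree.CorrectWiring J := jumpCorrect_withJump_iff.1 (hJ ▸ hR)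
  obtain ⟨hK', h⟩ := rewiringEquiv_of_rewires hcor (hcor.rewires_of_targets hab hne hcan)
  have hcanon : R.canonicalJumpVersion m = R.underlyingJumpFree.withJump fun n => some (K n) :=
    congrArg R.underlyingJumpFree.withJump (funext hK)
  refine ⟨hcanon ▸ jumpCorrect_withJump_iff.2 hK', ?_⟩
  convert h

theorem exists_not_erasing (hR : R.JumpCorrect) : ∃ m, ¬ R.underlyingJumpFree.Erasing m := by
  obtain ⟨J, hJ⟩ := eq_withJump_of_jumpTotal hR.1
  exact (jumpCorrect_withJump_iff.1 (hJ ▸ hR) :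
    R.underlyingJumpFree.CorrectWiring J).exists_not_erasing

end TypedProofStructure

theorem mainTheorem5 {N A : Type*} :
    (∀ (R : TypedProofStructure N A) (hR : R.JumpCorrect),
      R.CutFree → R.InFragment MLLFormula.notBotTensorLL →
      ∀ m : N, ¬ R.Erasing m →
        ∃ hm : (R.canonicalJumpVersion m).JumpCorrect,
          TypedProofStructure.RewiringEquiv ⟨R, hR⟩ ⟨R.canonicalJumpVersion m, hm⟩) ∧
    (∀ (R₁ R₂ : TypedProofStructure N A) (h₁ : R₁.JumpCorrect) (h₂ : R₂.JumpCorrect),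
      R₁.CutFree → R₂.CutFree →
      R₁.InFragment MLLFormula.notBotTensorLL → R₂.InFragment MLLFormula.notBotTensorLL →
      R₁.underlyingJumpFree = R₂.underlyingJumpFree →
        TypedProofStructure.RewiringEquiv ⟨R₁, h₁⟩ ⟨R₂, h₂⟩) := by
  refine ⟨fun R hR hcut hF m hm => ?_, fun R₁ R₂ h₁ h₂ hc₁ hc₂ hF₁ hF₂ heq => ?_⟩
  · exact TypedProofStructure.exists_rewiringEquiv_canonicalJumpVersion hR hcut hF fun h =>
      hm (TypedProofStructure.erasing_underlyingJumpFree h)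
  · obtain ⟨m, hm⟩ := TypedProofStructure.exists_not_erasing h₁
    -- The same `m` serves both structures, since being erasing is tested in the common jump-free
    -- structure.
    have hcanon : R₁.canonicalJumpVersion m = R₂.canonicalJumpVersion m := by
      unfold TypedProofStructure.canonicalJumpVersion
      rw [heq]
    obtain ⟨k₁, e₁⟩ :=
      TypedProofStructure.exists_rewiringEquiv_canonicalJumpVersion h₁ hc₁ hF₁ hm
    obtain ⟨k₂, e₂⟩ :=
      TypedProofStructure.exists_rewiringEquiv_canonicalJumpVersion h₂ hc₂ hF₂ (heq ▸ hm)
    simp only [hcanon] at e₁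
    exact e₁.trans _ _ _ e₂.symm
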